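/- A probability distribution $D$ on $\mathbf{R}^d$ is \emph{isotropic log-concave} if it has a density of the form $\exp(-\psi(x))$ for a convex function $\psi:\mathbf{R}^d\to\mathbf{R}\cup\{+\infty\}$, its mean is $0$ and its covariance matrix is the identity. For $u\in\mathbf{R}^d$ and $\gamma>0$ let $D_{u,\gamma}$ denote $D$ conditioned on the band $\{x\in\mathbf{R}^d : |u\cdot x|\le\gamma\}$. For every real number $C$ there is a constant $c>0$, depending only on $C$ (in particular not on the dimension), such that the following holds. For every $d$, every isotropic log-concave distribution $D$ on $\mathbf{R}^d$, every $\gamma$ with $0<\gamma\le C$, every real $r$, and all $u,a\in\mathbf{R}^d$ with $\|a\|_2\le 1$ and $\|u-a\|_2\le r$, the band $\{x:|u\cdot x|\le\gamma\}$ has positive $D$-probability (so that $D_{u,\gamma}$ is well defined), $(a\cdot x)^2$ is integrable with respect to $D_{u,\gamma}$, and $$\mathbf{E}_{x\sim D_{u,\gamma}}\left[(a\cdot x)^2\right]\le c\,(r^2+\gamma^2)\,\ln^2\!\left(1+\frac1\gamma\right).$$ -/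

import Mathlib

open MeasureTheory ProbabilityTheory

noncomputable section

/-- `D` has a density of the form `exp (-ψ)` with `ψ` convex. The convex function may take the value
`+∞`: it is given as a real convex function `ψ` on a convex set `K` (its effective domain), the
density being `0` outside `K`. -/
def HasLogConcaveDensity {d : ℕ} (D : Measure (EuclideanSpace ℝ (Fin d))) : Prop :=
  ∃ (K : Set (EuclideanSpace ℝ (Fin d))) (ψ : EuclideanSpace ℝ (Fin d) → ℝ),
    ConvexOn ℝ K ψ ∧
      D = volume.withDensity (K.indicator fun x => ENNReal.ofReal (Real.exp (-ψ x)))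

/-- Isotropic log-concave probability distributions on `ℝ^d`: log-concave density, finite second
moments, mean `0` and covariance matrix equal to the identity. -/
structure IsIsotropicLogConcave {d : ℕ} (D : Measure (EuclideanSpace ℝ (Fin d))) : Prop where
  isProbabilityMeasure : IsProbabilityMeasure D
  hasLogConcaveDensity : HasLogConcaveDensity D
  memLp_two : MemLp (fun x => x) 2 D
  mean_eq_zero : ∫ x, x ∂D = 0
  covariance_eq_one :
    (Matrix.of fun i j : Fin d => cov[fun x => x i, fun x => x j; D]) = 1

/-- The band `{x : |u · x| ≤ γ}`. -/
def band {d : ℕ} (u : EuclideanSpace ℝ (Fin d)) (γ : ℝ) : Set (EuclideanSpace ℝ (Fin d)) :=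
  {x | |inner ℝ u x| ≤ γ}

/-- The distribution `D_{u,γ}`: `D` conditioned on membership in the band. -/
def bandCond {d : ℕ} (D : Measure (EuclideanSpace ℝ (Fin d))) (u : EuclideanSpace ℝ (Fin d))
    (γ : ℝ) : Measure (EuclideanSpace ℝ (Fin d)) :=
  ProbabilityTheory.cond D (band u γ)

end

open scoped ENNReal Pointwise

/-! By Prékopa–Leindler every linear image `b · x` of `D` has a log-concave law, and isotropy gives
it mean 0 and variance `‖b‖ ^ 2`. So everything reduces to facts about one real variable `X`,
log-concave with mean 0 and variance 1, which makes the constants independent of the dimension.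

Two such facts suffice. Borell's exponential tail shows that an event of probability `p` carries
second moment at most of order `p (1 + ln² (1/p))` (`setIntegral_sq_le_log`). The small ball bound,
that `|X| ≤ s` has probability at least a constant times `s` for `s ≤ 1`
(`smallBallConst_mul_le_measureReal`), makes `ln (1/p)` for the band at most a constant plus `max
‖u‖ 1 * ln (1 + 1/γ)`.

If `‖u‖ ≤ 2`, split `a = u - (u - a)`: the band controls `u · x` by `γ`, and the second moment of
`(u - a) · x` costs `r² ln²`. If `‖u‖ > 2`, then `‖a‖ ≤ 1` forces `‖u‖ ≤ 2 r`, so the loss of `‖u‖²`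
in the logarithmic factor is absorbed by `r²`. Since `γ ≤ C`, the logarithm is bounded below and
absorbs additive constants. -/

/-! ### Brunn–Minkowski on the line and the Prékopa–Leindler inequality -/

theorem volume_add_volume_le_of_isCompact {A B C : Set ℝ} (hA : IsCompact A) (hB : IsCompact B)
    (hA' : A.Nonempty) (hB' : B.Nonempty) (h : ∀ x ∈ A, ∀ y ∈ B, x + y ∈ C) :
    volume A + volume B ≤ volume C := by
  have ha := hA.sSup_mem hA'
  have hb := hB.sInf_mem hB'
  have hB2 : MeasurableSet ((fun y => -sSup A + y) ⁻¹' B) :=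
    hB.measurableSet.preimage (measurable_const_add _)
  -- `A + inf B` and `sup A + B` both lie in `C` and meet at most in the point `sup A + inf B`.
  have hd : AEDisjoint volume ((fun x => -sInf B + x) ⁻¹' A) ((fun y => -sSup A + y) ⁻¹' B) := by
    refine measure_mono_null (t := {sSup A + sInf B}) ?_ (by simp)
    rintro z ⟨h1, h2⟩
    have h3 := le_csSup hA.bddAbove h1
    have h4 := csInf_le hB.bddBelow h2
    simp only [Set.mem_singleton_iff]
    linarith
  have h1 : volume ((fun x => -sInf B + x) ⁻¹' A) = volume A := measure_preimage_add _ _ _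
  have h2 : volume ((fun y => -sSup A + y) ⁻¹' B) = volume B := measure_preimage_add _ _ _
  rw [← h1, ← h2, ← measure_union₀ hB2.nullMeasurableSet hd]
  refine measure_mono (Set.union_subset ?_ ?_)
  · intro z hz
    have := h _ hz _ hb
    simpa using this
  · intro z hz
    have := h _ ha _ hz
    simpa using this

theorem volume_add_volume_le {A B C : Set ℝ} (hA : MeasurableSet A) (hB : MeasurableSet B)
    (hA' : A.Nonempty) (hB' : B.Nonempty) (h : ∀ x ∈ A, ∀ y ∈ B, x + y ∈ C) :
    volume A + volume B ≤ volume C := by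
  obtain ⟨a, ha⟩ := hA'
  obtain ⟨b, hb⟩ := hB'
  rw [hA.measure_eq_iSup_isCompact, hB.measure_eq_iSup_isCompact]
  simp only [iSup_and']
  refine ENNReal.biSup_add_biSup_le' ⟨∅, by simp⟩ ⟨∅, by simp⟩ ?_
  rintro K ⟨hK, hKc⟩ K' ⟨hK', hKc'⟩
  -- Adjoining `a` and `b` keeps the inner compact sets nonempty.
  calc volume K + volume K' ≤ volume (insert a K) + volume (insert b K') := by
        gcongr <;> exact Set.subset_insert _ _
    _ ≤ volume C := by
        refine volume_add_volume_le_of_isCompact (hKc.insert a) (hKc'.insert b) (by simp) (by simp) ?_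
        intro x hx y hy
        exact h x (Set.insert_subset ha hK hx) y (Set.insert_subset hb hK' hy)

theorem smul_volume_add_smul_volume_le {l : ℝ} (hl0 : 0 < l) (hl1 : l < 1) {A B C : Set ℝ}
    (hA : MeasurableSet A) (hB : MeasurableSet B) (hA' : A.Nonempty) (hB' : B.Nonempty)
    (h : ∀ x ∈ A, ∀ y ∈ B, (1 - l) * x + l * y ∈ C) :
    ENNReal.ofReal (1 - l) * volume A + ENNReal.ofReal l * volume B ≤ volume C := by
  have h1 : ENNReal.ofReal (1 - l) * volume A = volume ((1 - l) • A) := by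
    rw [Measure.addHaar_smul]; simp [abs_of_pos (sub_pos.2 hl1)]
  have h2 : ENNReal.ofReal l * volume B = volume (l • B) := by
    rw [Measure.addHaar_smul]; simp [abs_of_pos hl0]
  rw [h1, h2]
  refine volume_add_volume_le (hA.const_smul₀ _) (hB.const_smul₀ _) hA'.smul_set hB'.smul_set ?_
  rintro _ ⟨x, hx, rfl⟩ _ ⟨y, hy, rfl⟩
  simpa using h x hx y hy

theorem lintegral_eq_setLIntegral_meas_lt {α : Type*} [MeasurableSpace α] (μ : Measure α)
    {f : α → ℝ≥0∞} (hf : Measurable f) (hf1 : ∀ x, f x ≤ 1) :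
    ∫⁻ x, f x ∂μ = ∫⁻ t in Set.Ioo (0 : ℝ) 1, μ {x | ENNReal.ofReal t < f x} := by
  have hfin : ∀ x, f x ≠ ∞ := fun x => ne_top_of_le_ne_top ENNReal.one_ne_top (hf1 x)
  have h1 : ∫⁻ x, f x ∂μ = ∫⁻ x, ENNReal.ofReal (f x).toReal ∂μ := by
    simp only [ENNReal.ofReal_toReal (hfin _)]
  rw [h1, lintegral_eq_lintegral_meas_lt μ (.of_forall fun x => ENNReal.toReal_nonneg)
    hf.ennreal_toReal.aemeasurable]
  have h2 : ∀ t ∈ Set.Ioi (0 : ℝ), μ {x | t < (f x).toReal}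
      = (Set.Iio (1 : ℝ)).indicator (fun t => μ {x | ENNReal.ofReal t < f x}) t := by
    intro t ht
    have h3 : {x | t < (f x).toReal} = {x | ENNReal.ofReal t < f x} := by
      ext x
      exact (ENNReal.ofReal_lt_iff_lt_toReal (le_of_lt ht) (hfin x)).symm
    by_cases h : t < 1
    · rw [Set.indicator_of_mem (by exact h), h3]
    · rw [Set.indicator_of_notMem (by exact h), h3]
      convert measure_empty (μ := μ)
      ext x
      simp only [Set.mem_ofPred_eq, Set.mem_empty_iff_false, iff_false, not_lt]
      refine (hf1 x).trans ?_
      rw [← ENNReal.ofReal_one]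
      exact ENNReal.ofReal_le_ofReal (not_lt.1 h)
  rw [setLIntegral_congr_fun measurableSet_Ioi h2, lintegral_indicator measurableSet_Iio,
    Measure.restrict_restrict measurableSet_Iio, Set.inter_comm, Set.Ioi_inter_Iio]

theorem setLIntegral_meas_lt_le {α : Type*} [MeasurableSpace α] (μ : Measure α)
    {f : α → ℝ≥0∞} (hf : Measurable f) :
    ∫⁻ t in Set.Ioo (0 : ℝ) 1, μ {x | ENNReal.ofReal t < f x} ≤ ∫⁻ x, f x ∂μ := by
  calc ∫⁻ t in Set.Ioo (0 : ℝ) 1, μ {x | ENNReal.ofReal t < f x}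
      = ∫⁻ t in Set.Ioo (0 : ℝ) 1, μ {x | ENNReal.ofReal t < min (f x) 1} := by
        refine setLIntegral_congr_fun measurableSet_Ioo fun t ht => ?_
        have : ENNReal.ofReal t < 1 := by simpa using ht.2
        simp [this]
    _ = ∫⁻ x, min (f x) 1 ∂μ :=
        (lintegral_eq_setLIntegral_meas_lt μ (hf.min measurable_const) fun x => min_le_right _ _).symm
    _ ≤ _ := lintegral_mono fun x => min_le_left _ _

theorem ENNReal.rpow_mul_rpow_le_add {l : ℝ} (hl0 : 0 < l) (hl1 : l < 1) (a b : ℝ≥0∞) :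
    a ^ (1 - l) * b ^ l ≤ ENNReal.ofReal (1 - l) * a + ENNReal.ofReal l * b := by
  have h1 : 0 < 1 - l := sub_pos.2 hl1
  induction a with
  | top => simp [ENNReal.mul_top, hl1]
  | coe a =>
    induction b with
    | top => simp [ENNReal.mul_top, hl0]
    | coe b =>
      have := NNReal.geom_mean_le_arith_mean2_weighted (1 - l).toNNReal l.toNNReal a b
        (by rw [← Real.toNNReal_add h1.le hl0.le]; simp)
      rw [Real.coe_toNNReal _ h1.le, Real.coe_toNNReal _ hl0.le] at this
      rw [← ENNReal.coe_rpow_of_nonneg _ h1.le, ← ENNReal.coe_rpow_of_nonneg _ hl0.le]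
      simp only [ENNReal.ofReal]
      exact_mod_cast this

/-- With both suprema equal to 1, the superlevel sets of `f` and `g` are nonempty at every level `t
< 1`, so Brunn–Minkowski applies level by level. Integrating over `t` gives an arithmetic mean,
stronger than the geometric one. -/
theorem add_lintegral_le_of_iSup_eq_one {l : ℝ} (hl0 : 0 < l) (hl1 : l < 1) {f g h : ℝ → ℝ≥0∞}
    (hf : Measurable f) (hg : Measurable g) (hh : Measurable h)
    (hf1 : ⨆ x, f x = 1) (hg1 : ⨆ x, g x = 1)
    (hfgh : ∀ x y, f x ^ (1 - l) * g y ^ l ≤ h ((1 - l) * x + l * y)) :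
    ENNReal.ofReal (1 - l) * (∫⁻ x, f x) + ENNReal.ofReal l * (∫⁻ x, g x) ≤ ∫⁻ x, h x := by
  have h1 : 0 < 1 - l := sub_pos.2 hl1
  refine le_trans ?_ (setLIntegral_meas_lt_le volume hh)
  have anti : ∀ f : ℝ → ℝ≥0∞,
      Measurable fun t : ℝ => volume {x | ENNReal.ofReal t < f x} := fun f =>
    Antitone.measurable fun s t hst => measure_mono fun x hx =>
      lt_of_le_of_lt (ENNReal.ofReal_le_ofReal hst) hx
  rw [lintegral_eq_setLIntegral_meas_lt volume hf (fun x => hf1 ▸ le_iSup f x),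
    lintegral_eq_setLIntegral_meas_lt volume hg (fun x => hg1 ▸ le_iSup g x),
    ← lintegral_const_mul _ (anti f), ← lintegral_const_mul _ (anti g),
    ← lintegral_add_left ((anti f).const_mul _)]
  refine setLIntegral_mono (anti h) fun t ht => ?_
  have ht1 : ENNReal.ofReal t < 1 := by simpa using ht.2
  refine smul_volume_add_smul_volume_le hl0 hl1 (measurableSet_lt measurable_const hf)
    (measurableSet_lt measurable_const hg) ?_ ?_ ?_
  · obtain ⟨x, hx⟩ := lt_iSup_iff.1 (hf1 ▸ ht1)
    exact ⟨x, hx⟩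
  · obtain ⟨x, hx⟩ := lt_iSup_iff.1 (hg1 ▸ ht1)
    exact ⟨x, hx⟩
  intro x hx y hy
  refine lt_of_lt_of_le ?_ (hfgh x y)
  calc ENNReal.ofReal t = ENNReal.ofReal t ^ (1 - l) * ENNReal.ofReal t ^ l := by
        rw [← ENNReal.rpow_add_of_nonneg _ _ h1.le hl0.le]; simp
    _ < f x ^ (1 - l) * g y ^ l :=
        ENNReal.mul_lt_mul (ENNReal.rpow_lt_rpow hx h1) (ENNReal.rpow_lt_rpow hy hl0)

theorem prekopa_leindler_real_of_bounded {l : ℝ} (hl0 : 0 < l) (hl1 : l < 1) {f g h : ℝ → ℝ≥0∞}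
    (hf : Measurable f) (hg : Measurable g) (hh : Measurable h)
    (hf1 : ⨆ x, f x ≠ ∞) (hg1 : ⨆ x, g x ≠ ∞)
    (hfgh : ∀ x y, f x ^ (1 - l) * g y ^ l ≤ h ((1 - l) * x + l * y)) :
    (∫⁻ x, f x) ^ (1 - l) * (∫⁻ x, g x) ^ l ≤ ∫⁻ x, h x := by
  have h1 : 0 < 1 - l := sub_pos.2 hl1
  rcases eq_or_ne (⨆ x, f x) 0 with hF | hF
  · have : ∀ x, f x = 0 := fun x => le_antisymm (hF ▸ le_iSup f x) bot_le
    simp [this, h1]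
  rcases eq_or_ne (⨆ x, g x) 0 with hG | hG
  · have : ∀ x, g x = 0 := fun x => le_antisymm (hG ▸ le_iSup g x) bot_le
    simp [this, hl0]
  set F := ⨆ x, f x
  set G := ⨆ x, g x
  -- Dividing `f`, `g`, `h` by `F`, `G`, `c` preserves the hypothesis and makes both suprema 1.
  set c := F ^ (1 - l) * G ^ l with hc
  have hc0 : c ≠ 0 := by
    simp [hc, hF, hG, hf1, hg1]
  have hct : c ≠ ∞ := ENNReal.mul_ne_top (ENNReal.rpow_ne_top_of_nonneg h1.le hf1)
    (ENNReal.rpow_ne_top_of_nonneg hl0.le hg1)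
  have key : ∀ a b : ℝ≥0∞, (F⁻¹ * a) ^ (1 - l) * (G⁻¹ * b) ^ l = c⁻¹ * (a ^ (1 - l) * b ^ l) := by
    intro a b
    rw [ENNReal.mul_rpow_of_nonneg _ _ h1.le, ENNReal.mul_rpow_of_nonneg _ _ hl0.le, hc,
      ENNReal.mul_inv (Or.inr (ENNReal.rpow_ne_top_of_nonneg hl0.le hg1))
        (Or.inl (ENNReal.rpow_ne_top_of_nonneg h1.le hf1)), ENNReal.inv_rpow, ENNReal.inv_rpow]
    ring
  have := add_lintegral_le_of_iSup_eq_one hl0 hl1 (hf.const_mul F⁻¹) (hg.const_mul G⁻¹)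
    (hh.const_mul c⁻¹) (by rw [← ENNReal.mul_iSup]; exact ENNReal.inv_mul_cancel hF hf1)
    (by rw [← ENNReal.mul_iSup]; exact ENNReal.inv_mul_cancel hG hg1)
    (fun x y => by rw [key]; gcongr; exact hfgh x y)
  rw [lintegral_const_mul _ hf, lintegral_const_mul _ hg, lintegral_const_mul _ hh] at this
  have := (ENNReal.rpow_mul_rpow_le_add hl0 hl1 _ _).trans this
  rw [key] at this
  exact (ENNReal.mul_le_mul_iff_right (ENNReal.inv_ne_zero.2 hct) (ENNReal.inv_ne_top.2 hc0)).1 this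

theorem ENNReal.iSup_min_natCast (a : ℝ≥0∞) : ⨆ n : ℕ, min a n = a := by
  rw [← inf_iSup_eq, ENNReal.iSup_natCast, inf_top_eq]

theorem lintegral_eq_iSup_lintegral_min {α : Type*} [MeasurableSpace α] (μ : Measure α)
    {f : α → ℝ≥0∞} (hf : Measurable f) :
    ∫⁻ x, f x ∂μ = ⨆ n : ℕ, ∫⁻ x, min (f x) n ∂μ := by
  rw [← lintegral_iSup (fun n => hf.min measurable_const)]
  · simp only [ENNReal.iSup_min_natCast]
  · intro m n hmn x
    exact min_le_min_left _ (by exact_mod_cast hmn)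

/-- The one-dimensional Prékopa–Leindler inequality. -/
theorem prekopa_leindler_real {l : ℝ} (hl0 : 0 < l) (hl1 : l < 1) {f g h : ℝ → ℝ≥0∞}
    (hf : Measurable f) (hg : Measurable g) (hh : Measurable h)
    (hfgh : ∀ x y, f x ^ (1 - l) * g y ^ l ≤ h ((1 - l) * x + l * y)) :
    (∫⁻ x, f x) ^ (1 - l) * (∫⁻ x, g x) ^ l ≤ ∫⁻ x, h x := by
  have h1 : 0 < 1 - l := sub_pos.2 hl1
  have rpow_iSup : ∀ {p : ℝ} (hp : 0 < p) (a : ℕ → ℝ≥0∞), (⨆ n, a n) ^ p = ⨆ n, a n ^ p :=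
    fun hp a => (ENNReal.orderIsoRpow _ hp).map_iSup a
  have bdd : ∀ (f : ℝ → ℝ≥0∞) (n : ℕ), ⨆ x, min (f x) n ≠ ∞ := fun f n =>
    ne_top_of_le_ne_top (ENNReal.natCast_ne_top n) (iSup_le fun x => min_le_right _ _)
  -- Truncating `f` and `g` preserves the hypothesis with the same `h`; monotone convergence removes
  -- the truncation.
  rw [lintegral_eq_iSup_lintegral_min _ hf, lintegral_eq_iSup_lintegral_min _ hg, rpow_iSup h1,
    rpow_iSup hl0, ENNReal.iSup_mul]
  refine iSup_le fun m => ?_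
  rw [ENNReal.mul_iSup]
  refine iSup_le fun n => ?_
  refine prekopa_leindler_real_of_bounded hl0 hl1 (hf.min measurable_const)
    (hg.min measurable_const) hh (bdd f m) (bdd g n) fun x y => le_trans ?_ (hfgh x y)
  gcongr <;> exact min_le_left _ _

theorem lintegral_fin_succ {n : ℕ} {f : (Fin (n + 1) → ℝ) → ℝ≥0∞} (hf : Measurable f) :
    ∫⁻ x, f x = ∫⁻ s : ℝ, ∫⁻ y : Fin n → ℝ, f (Fin.cons s y) := by
  have e := (volume_preserving_piFinSuccAbove (fun _ : Fin (n + 1) => ℝ) 0).symm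
  rw [← e.lintegral_comp hf, Measure.volume_eq_prod,
    lintegral_prod (fun a => f _) (hf.comp e.measurable).aemeasurable]
  simp [MeasurableEquiv.piFinSuccAbove, Fin.consEquiv]

theorem measurable_fin_cons {n : ℕ} :
    Measurable fun p : ℝ × (Fin n → ℝ) => (Fin.cons p.1 p.2 : Fin (n + 1) → ℝ) := by
  refine measurable_pi_iff.2 fun i => ?_
  refine Fin.cases ?_ (fun j => ?_) i
  · simpa using measurable_fst
  · simpa using measurable_pi_iff.1 measurable_snd j

/-- The Prékopa–Leindler inequality. -/
theorem prekopa_leindler {l : ℝ} (hl0 : 0 < l) (hl1 : l < 1) {n : ℕ}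
    {f g h : (Fin n → ℝ) → ℝ≥0∞} (hf : Measurable f) (hg : Measurable g) (hh : Measurable h)
    (hfgh : ∀ x y, f x ^ (1 - l) * g y ^ l ≤ h ((1 - l) • x + l • y)) :
    (∫⁻ x, f x) ^ (1 - l) * (∫⁻ x, g x) ^ l ≤ ∫⁻ x, h x := by
  induction n with
  | zero =>
    have hv : (volume : Measure (Fin 0 → ℝ)) Set.univ = 1 := by
      simp [volume_pi]
    simp only [lintegral_unique, hv, mul_one]
    convert hfgh default default
  | succ n ih =>
    rw [lintegral_fin_succ hf, lintegral_fin_succ hg, lintegral_fin_succ hh]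
    have m : ∀ {f : (Fin (n + 1) → ℝ) → ℝ≥0∞}, Measurable f →
        Measurable fun p : ℝ × (Fin n → ℝ) => f (Fin.cons p.1 p.2) :=
      fun hf => hf.comp measurable_fin_cons
    have m' : ∀ {f : (Fin (n + 1) → ℝ) → ℝ≥0∞} (s : ℝ), Measurable f →
        Measurable fun y : Fin n → ℝ => f (Fin.cons s y) :=
      fun s hf => (m hf).comp measurable_prodMk_left
    -- The inductive hypothesis on fibres is exactly the one-dimensional hypothesis for the fibre
    -- integrals.
    refine prekopa_leindler_real hl0 hl1 (m hf).lintegral_prod_right' (m hg).lintegral_prod_right'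
      (m hh).lintegral_prod_right' fun s t => ih (m' s hf) (m' t hg) (m' _ hh) fun x y => ?_
    refine (hfgh _ _).trans_eq ?_
    congr 1
    ext i
    refine Fin.cases ?_ (fun j => ?_) i <;> simp

/-! ### Log-concave measures -/

/-- A measure satisfying the multiplicative Brunn–Minkowski inequality
`μ A ^ (1 - l) * μ B ^ l ≤ μ C` whenever `(1 - l) A + l B ⊆ C`. -/
def IsLogConcaveMeasure {E : Type*} [AddCommGroup E] [Module ℝ E] [MeasurableSpace E]
    (μ : Measure E) : Prop :=
  ∀ l : ℝ, 0 < l → l < 1 → ∀ A B C : Set E, MeasurableSet A → MeasurableSet B → MeasurableSet C →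
    (∀ x ∈ A, ∀ y ∈ B, (1 - l) • x + l • y ∈ C) → μ A ^ (1 - l) * μ B ^ l ≤ μ C

theorem IsLogConcaveMeasure.map {E F : Type*} [AddCommGroup E] [Module ℝ E] [MeasurableSpace E]
    [AddCommGroup F] [Module ℝ F] [MeasurableSpace F] {μ : Measure E} (hμ : IsLogConcaveMeasure μ)
    (L : E →ₗ[ℝ] F) (hL : Measurable L) : IsLogConcaveMeasure (μ.map L) := by
  intro l hl0 hl1 A B C hA hB hC h
  rw [Measure.map_apply hL hA, Measure.map_apply hL hB, Measure.map_apply hL hC]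
  refine hμ l hl0 hl1 _ _ _ (hL hA) (hL hB) (hL hC) fun x hx y hy => ?_
  have := h _ hx _ hy
  simpa using this

theorem IsLogConcaveMeasure.real_le {E : Type*} [AddCommGroup E] [Module ℝ E] [MeasurableSpace E]
    {μ : Measure E} [IsFiniteMeasure μ] (hμ : IsLogConcaveMeasure μ) {l : ℝ} (hl0 : 0 < l)
    (hl1 : l < 1) {A B C : Set E} (hA : MeasurableSet A) (hB : MeasurableSet B)
    (hC : MeasurableSet C) (h : ∀ x ∈ A, ∀ y ∈ B, (1 - l) • x + l • y ∈ C) :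
    μ.real A ^ (1 - l) * μ.real B ^ l ≤ μ.real C := by
  have := ENNReal.toReal_mono (measure_ne_top μ C) (hμ l hl0 hl1 A B C hA hB hC h)
  rwa [ENNReal.toReal_mul, ← ENNReal.toReal_rpow, ← ENNReal.toReal_rpow] at this

/-- Prékopa–Leindler applied to the density cut off to `A`, `B` and `C`. -/
theorem isLogConcaveMeasure_withDensity {d : ℕ} {f : EuclideanSpace ℝ (Fin d) → ℝ≥0∞}
    (hf : Measurable f)
    (h : ∀ l : ℝ, 0 < l → l < 1 → ∀ x y, f x ^ (1 - l) * f y ^ l ≤ f ((1 - l) • x + l • y)) :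
    IsLogConcaveMeasure (volume.withDensity f) := by
  intro l hl0 hl1 A B C hA hB hC hABC
  have h1 : 0 < 1 - l := sub_pos.2 hl1
  have e := PiLp.volume_preserving_toLp (Fin d)
  have key : ∀ {S : Set (EuclideanSpace ℝ (Fin d))}, MeasurableSet S →
      volume.withDensity f S = ∫⁻ y : Fin d → ℝ, S.indicator f (WithLp.toLp 2 y) := fun {S} hS => by
    rw [withDensity_apply _ hS, ← lintegral_indicator hS, ← e.lintegral_comp (hf.indicator hS)]
  rw [key hA, key hB, key hC]
  refine prekopa_leindler hl0 hl1 ((hf.indicator hA).comp e.measurable)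
    ((hf.indicator hB).comp e.measurable) ((hf.indicator hC).comp e.measurable) fun x y => ?_
  by_cases hx : WithLp.toLp 2 x ∈ A
  · by_cases hy : WithLp.toLp 2 y ∈ B
    · have := hABC _ hx _ hy
      rw [← WithLp.toLp_smul, ← WithLp.toLp_smul, ← WithLp.toLp_add] at this
      rw [Set.indicator_of_mem hx, Set.indicator_of_mem hy, Set.indicator_of_mem this]
      exact h l hl0 hl1 _ _
    · simp [Set.indicator_of_notMem hy, hl0]
  · simp [Set.indicator_of_notMem hx, h1]

theorem HasLogConcaveDensity.isLogConcaveMeasure {d : ℕ} {D : Measure (EuclideanSpace ℝ (Fin d))}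
    (hD : HasLogConcaveDensity D) : IsLogConcaveMeasure D := by
  obtain ⟨K, ψ, hψ, rfl⟩ := hD
  -- `ψ` need not be measurable on the boundary of `K`. A convex set has null frontier, and `ψ` is
  -- continuous on the interior.
  have hae : (K.indicator fun x => ENNReal.ofReal (Real.exp (-ψ x))) =ᵐ[volume]
      (interior K).indicator fun x => ENNReal.ofReal (Real.exp (-ψ x)) :=
    indicator_ae_eq_of_ae_eq_set
      (interior_ae_eq_of_null_frontier (hψ.1.addHaar_frontier volume)).symm
  rw [withDensity_congr_ae hae]
  refine isLogConcaveMeasure_withDensity ?_ fun l hl0 hl1 x y => ?_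
  · classical
    rw [← Set.piecewise_eq_indicator]
    refine ContinuousOn.measurable_piecewise ?_ continuousOn_const isOpen_interior.measurableSet
    exact ENNReal.continuous_ofReal.comp_continuousOn
      (Real.continuous_exp.comp_continuousOn hψ.continuousOn_interior.neg)
  · have h1 : 0 < 1 - l := sub_pos.2 hl1
    by_cases hx : x ∈ interior K
    · by_cases hy : y ∈ interior K
      · have hxy := hψ.1.interior hx hy h1.le hl0.le (by ring)
        have hle := hψ.2 (interior_subset hx) (interior_subset hy) h1.le hl0.le (by ring)
        rw [Set.indicator_of_mem hx, Set.indicator_of_mem hy, Set.indicator_of_mem hxy,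
          ENNReal.ofReal_rpow_of_pos (Real.exp_pos _), ENNReal.ofReal_rpow_of_pos (Real.exp_pos _),
          ← ENNReal.ofReal_mul (by positivity), ← Real.exp_mul, ← Real.exp_mul, ← Real.exp_add]
        refine ENNReal.ofReal_le_ofReal (Real.exp_le_exp.2 ?_)
        simp only [smul_eq_mul] at hle
        linarith
      · simp [Set.indicator_of_notMem hy, hl0]
    · simp [Set.indicator_of_notMem hx, h1]

/-! ### Linear marginals of an isotropic log-concave distribution -/

namespace IsIsotropicLogConcave

variable {d : ℕ} {D : Measure (EuclideanSpace ℝ (Fin d))}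

theorem isLogConcaveMeasure_map_inner (hD : IsIsotropicLogConcave D)
    (b : EuclideanSpace ℝ (Fin d)) : IsLogConcaveMeasure (D.map fun x => inner ℝ b x) :=
  hD.hasLogConcaveDensity.isLogConcaveMeasure.map (innerSL ℝ b).toLinearMap
    (innerSL ℝ b).continuous.measurable

theorem memLp_inner (hD : IsIsotropicLogConcave D) (b : EuclideanSpace ℝ (Fin d)) :
    MemLp (fun x => (inner ℝ b x : ℝ)) 2 D :=
  hD.memLp_two.const_inner b

theorem integral_inner_eq_zero (hD : IsIsotropicLogConcave D) (b : EuclideanSpace ℝ (Fin d)) :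
    ∫ x, (inner ℝ b x : ℝ) ∂D = 0 := by
  have := hD.isProbabilityMeasure
  rw [integral_inner (hD.memLp_two.integrable one_le_two), hD.mean_eq_zero, inner_zero_right]

theorem integral_inner_sq (hD : IsIsotropicLogConcave D) (b : EuclideanSpace ℝ (Fin d)) :
    ∫ x, (inner ℝ b x : ℝ) ^ 2 ∂D = ‖b‖ ^ 2 := by
  have := hD.isProbabilityMeasure
  have h1 : ∫ x, (inner ℝ b x : ℝ) ^ 2 ∂D = cov[fun x => inner ℝ b x, fun x => inner ℝ b x; D] := by
    rw [covariance_eq_sub (hD.memLp_inner b) (hD.memLp_inner b), hD.integral_inner_eq_zero]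
    simp [sq]
  have hc : ∀ i : Fin d, MemLp (fun x : EuclideanSpace ℝ (Fin d) => x i * b i) 2 D := fun i => by
    have h := (hD.memLp_inner (EuclideanSpace.single i 1)).mul_const (b i)
    simpa [PiLp.inner_apply, PiLp.single_apply, EuclideanSpace.single, Pi.single_apply] using h
  have hcov : ∀ i j : Fin d, cov[fun x => x i, fun x => x j; D] = (1 : Matrix _ _ ℝ) i j :=
    fun i j => by rw [← hD.covariance_eq_one]; rfl
  rw [h1, EuclideanSpace.real_norm_sq_eq]
  simp only [PiLp.inner_apply, RCLike.inner_apply, conj_trivial]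
  rw [covariance_fun_sum_fun_sum hc hc]
  simp only [covariance_mul_const_left, covariance_mul_const_right, hcov]
  simp [Matrix.one_apply, sq]

end IsIsotropicLogConcave

/-! ### Exponential tails and truncated second moments -/

section LogConcaveVariable

variable {Ω : Type*} [MeasurableSpace Ω] {μ : Measure Ω} [IsProbabilityMeasure μ] {X : Ω → ℝ}

theorem measureReal_lt_abs_le_sq (hX : MemLp X 2 μ) {t : ℝ} (ht : 0 < t) :
    μ.real {ω | t < |X ω|} ≤ (∫ ω, X ω ^ 2 ∂μ) / t ^ 2 := by
  rw [le_div_iff₀ (by positivity), mul_comm]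
  refine le_trans ?_ (mul_meas_ge_le_integral_of_nonneg (.of_forall fun ω => sq_nonneg (X ω))
    hX.integrable_sq (t ^ 2))
  refine mul_le_mul_of_nonneg_left (measureReal_mono fun ω hω => ?_) (by positivity)
  have h : t < |X ω| := hω
  change t ^ 2 ≤ X ω ^ 2
  rw [← sq_abs (X ω)]
  gcongr

/-- Borell's tail bound for log-concave real random variables of unit second moment. -/
theorem measureReal_lt_abs_le_exp (hXm : Measurable X) (hlc : IsLogConcaveMeasure (μ.map X))
    (hX : MemLp X 2 μ) (h2 : ∫ ω, X ω ^ 2 ∂μ = 1) {t : ℝ} (ht : 0 ≤ t) :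
    μ.real {ω | t < |X ω|} ≤ 2 * Real.exp (-t / 4) := by
  rcases le_or_gt t 2 with ht2 | ht2
  · refine measureReal_le_one.trans ?_
    have := Real.add_one_le_exp (-t / 4)
    linarith
  have : IsProbabilityMeasure (μ.map X) := Measure.isProbabilityMeasure_map hXm.aemeasurable
  have mC : ∀ s : ℝ, MeasurableSet {x : ℝ | s < |x|} := fun s =>
    measurableSet_lt measurable_const measurable_id.abs
  have hreal : ∀ s, (μ.map X).real {x : ℝ | s < |x|} = μ.real {ω | s < |X ω|} := fun s => by
    rw [map_measureReal_apply hXm (mC s)]; rfl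
  have hC : (μ.map X).real {x : ℝ | 2 < |x|} ≤ 1 / 4 := by
    rw [hreal]
    refine (measureReal_lt_abs_le_sq hX two_pos).trans ?_
    rw [h2]; norm_num
  have hA : 3 / 4 ≤ (μ.map X).real {x : ℝ | 2 < |x|}ᶜ := by
    rw [probReal_compl_eq_one_sub (mC 2)]
    linarith
  -- Chosen so that `|x| ≤ 2` and `|y| > t` give `|(1 - l) x + l y| > l t - 2 (1 - l) = 2`. The set
  -- `|x| ≤ 2` has mass at least 3/4 and its complement at most 1/4, which bounds the tail at `t`.
  set l := 4 / (t + 2) with hl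
  have hl0 : 0 < l := by positivity
  have hl1 : l < 1 := by rw [hl, div_lt_one (by linarith)]; linarith
  have hlt : l * (t + 2) = 4 := by rw [hl]; field_simp
  have key := hlc.real_le hl0 hl1 (mC 2).compl (mC t) (mC 2) (by
    intro x hx y hy
    have hx : |x| ≤ 2 := not_lt.1 hx
    have hy : t < |y| := hy
    change 2 < |(1 - l) • x + l • y|
    have h1 : |l * y| ≤ |(1 - l) * x + l * y| + |(1 - l) * x| := by
      have := abs_sub ((1 - l) * x + l * y) ((1 - l) * x)
      simpa using this
    rw [abs_mul, abs_mul, abs_of_pos hl0, abs_of_pos (sub_pos.2 hl1)] at h1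
    have h3 : (1 - l) * |x| ≤ (1 - l) * 2 := by
      gcongr
    have h4 : l * t < l * |y| := by gcongr
    simp only [smul_eq_mul]
    linarith)
  rw [hreal t] at key
  rcases eq_or_lt_of_le (measureReal_nonneg (μ := μ) (s := {ω | t < |X ω|})) with h0 | h0
  · rw [← h0]; positivity
  set p := μ.real {ω | t < |X ω|}
  have h3 : (3 / 4 : ℝ) ^ (1 - l) * p ^ l ≤ 1 / 4 := by
    refine le_trans ?_ (key.trans hC)
    gcongr
  have h4 := Real.log_le_log (by positivity) h3
  rw [Real.log_mul (by positivity) (by positivity), Real.log_rpow (by norm_num),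
    Real.log_rpow h0, Real.log_div (by norm_num) (by norm_num),
    Real.log_div (by norm_num) (by norm_num), Real.log_one] at h4
  have h5 : 1 ≤ Real.log 3 := by
    rw [Real.le_log_iff_exp_le (by norm_num)]
    exact Real.exp_one_lt_d9.le.trans (by norm_num)
  have h6 : Real.log 3 ≤ Real.log 4 := Real.log_le_log (by norm_num) (by norm_num)
  have h7 : Real.log p ≤ -t / 4 := by
    have h8 : l * (Real.log p - Real.log 3 + Real.log 4) ≤ l * (-(Real.log 3) * (t + 2) / 4) := by
      have : l * (-(Real.log 3) * (t + 2) / 4) = - Real.log 3 := by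
        linear_combination (-(Real.log 3) / 4) * hlt
      rw [this]; linarith
    have h9 := le_of_mul_le_mul_left h8 hl0
    nlinarith
  rw [Real.log_le_iff_le_exp h0] at h7
  linarith [Real.exp_pos (-t / 4)]

theorem lintegral_exp_abs_le (hXm : Measurable X) (hlc : IsLogConcaveMeasure (μ.map X))
    (hX : MemLp X 2 μ) (h2 : ∫ ω, X ω ^ 2 ∂μ = 1) :
    ∫⁻ ω, ENNReal.ofReal (Real.exp (|X ω| / 8)) ∂μ ≤ ENNReal.ofReal 3 := by
  -- Layer cake for `exp (|X| / 8) - 1`: the tail `2 exp (-t / 4)` leaves an integrand `exp (-t / 8)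
  -- / 4`, of total mass 2.
  have hint : ∀ y : ℝ, ∫ t in (0 : ℝ)..y, (1 / 8) * Real.exp (t / 8) = Real.exp (y / 8) - 1 := by
    intro y
    rw [intervalIntegral.integral_eq_sub_of_hasDerivAt (f := fun t => Real.exp (t / 8))]
    · simp
    · intro t _
      have := ((hasDerivAt_id t).div_const 8).exp
      exact this.congr_deriv (mul_comm _ _)
    · exact Continuous.intervalIntegrable (by fun_prop) _ _
  have h := lintegral_comp_eq_lintegral_meas_lt_mul μ (f := fun ω => |X ω|)
    (g := fun t => (1 / 8) * Real.exp (t / 8)) (.of_forall fun ω => abs_nonneg _)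
    hXm.abs.aemeasurable (fun t _ => Continuous.intervalIntegrable (by fun_prop) _ _)
    (.of_forall fun t => by positivity)
  simp only [hint] at h
  have hb : ∫⁻ t in Set.Ioi (0 : ℝ), μ {ω | t < |X ω|} * ENNReal.ofReal (1 / 8 * Real.exp (t / 8))
      ≤ ENNReal.ofReal 2 := by
    calc _ ≤ ∫⁻ t in Set.Ioi (0 : ℝ), ENNReal.ofReal ((1 / 4) * Real.exp (-(1 / 8) * t)) := by
          refine setLIntegral_mono (by fun_prop) fun t ht => ?_
          rw [← ofReal_measureReal, ← ENNReal.ofReal_mul measureReal_nonneg]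
          refine ENNReal.ofReal_le_ofReal ?_
          calc _ ≤ 2 * Real.exp (-t / 4) * (1 / 8 * Real.exp (t / 8)) := by
                gcongr
                exact measureReal_lt_abs_le_exp hXm hlc hX h2 (le_of_lt ht)
            _ = 1 / 4 * (Real.exp (-t / 4) * Real.exp (t / 8)) := by ring
            _ = _ := by rw [← Real.exp_add]; ring_nf
      _ = ENNReal.ofReal 2 := by
          rw [← ofReal_integral_eq_lintegral_ofReal
            ((integrableOn_exp_mul_Ioi (by norm_num) 0).const_mul _)
            (.of_forall fun t => by positivity), integral_const_mul,
            integral_exp_mul_Ioi (by norm_num)]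
          norm_num
  calc ∫⁻ ω, ENNReal.ofReal (Real.exp (|X ω| / 8)) ∂μ
      = ∫⁻ ω, (ENNReal.ofReal (Real.exp (|X ω| / 8) - 1) + 1) ∂μ := by
        refine lintegral_congr fun ω => ?_
        rw [← ENNReal.ofReal_one, ← ENNReal.ofReal_add (by simp; positivity) zero_le_one, sub_add_cancel]
    _ = ∫⁻ ω, ENNReal.ofReal (Real.exp (|X ω| / 8) - 1) ∂μ + 1 := by
        rw [lintegral_add_right _ measurable_const]; simp
    _ ≤ ENNReal.ofReal 2 + ENNReal.ofReal 1 := by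
        rw [h, ENNReal.ofReal_one]; gcongr
    _ = ENNReal.ofReal 3 := by rw [← ENNReal.ofReal_add] <;> norm_num

theorem integrable_exp_abs (hXm : Measurable X) (hlc : IsLogConcaveMeasure (μ.map X))
    (hX : MemLp X 2 μ) (h2 : ∫ ω, X ω ^ 2 ∂μ = 1) :
    Integrable (fun ω => Real.exp (|X ω| / 8)) μ := by
  refine (lintegral_ofReal_ne_top_iff_integrable (by fun_prop)
    (.of_forall fun ω => by positivity)).1 ?_
  exact ne_top_of_le_ne_top ENNReal.ofReal_ne_top (lintegral_exp_abs_le hXm hlc hX h2)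

theorem integral_exp_abs_le (hXm : Measurable X) (hlc : IsLogConcaveMeasure (μ.map X))
    (hX : MemLp X 2 μ) (h2 : ∫ ω, X ω ^ 2 ∂μ = 1) :
    ∫ ω, Real.exp (|X ω| / 8) ∂μ ≤ 3 := by
  rw [integral_eq_lintegral_of_nonneg_ae (.of_forall fun ω => by positivity)
    (by fun_prop)]
  exact ENNReal.toReal_le_of_le_ofReal (by norm_num) (lintegral_exp_abs_le hXm hlc hX h2)

theorem sq_le_exp_neg_mul_exp_of_le_abs {x T : ℝ} (h : T ≤ |x|) :
    x ^ 2 ≤ 512 * Real.exp (-T / 16) * Real.exp (|x| / 8) := by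
  have h1 := Real.quadratic_le_exp_of_nonneg (x := |x| / 16) (by positivity)
  have h2 : Real.exp (|x| / 16) ≤ Real.exp (-T / 16) * Real.exp (|x| / 8) := by
    rw [← Real.exp_add]
    exact Real.exp_le_exp.2 (by linarith)
  nlinarith [abs_nonneg x, sq_abs x]

theorem setIntegral_sq_le (hXm : Measurable X) (hlc : IsLogConcaveMeasure (μ.map X))
    (hX : MemLp X 2 μ) (h2 : ∫ ω, X ω ^ 2 ∂μ = 1) (B : Set Ω) (T : ℝ) :
    ∫ ω in B, X ω ^ 2 ∂μ ≤ μ.real B * T ^ 2 + 1536 * Real.exp (-T / 16) := by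
  have hexp := integrable_exp_abs hXm hlc hX h2
  calc ∫ ω in B, X ω ^ 2 ∂μ
      ≤ ∫ ω in B, (T ^ 2 + 512 * Real.exp (-T / 16) * Real.exp (|X ω| / 8)) ∂μ := by
        refine integral_mono hX.integrable_sq.integrableOn
          ((integrable_const _).add (hexp.integrableOn.const_mul _)) fun ω => ?_
        rcases le_total T |X ω| with h | h
        · exact (sq_le_exp_neg_mul_exp_of_le_abs h).trans (by simp; positivity)
        · have : X ω ^ 2 ≤ T ^ 2 := by rw [← sq_abs]; gcongr
          exact this.trans (by simp; positivity)
    _ = μ.real B * T ^ 2 + 512 * Real.exp (-T / 16) * ∫ ω in B, Real.exp (|X ω| / 8) ∂μ := by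
        rw [integral_add (integrable_const _) (hexp.integrableOn.const_mul _), integral_const_mul]
        simp
    _ ≤ μ.real B * T ^ 2 + 512 * Real.exp (-T / 16) * 3 := by
        gcongr
        exact (setIntegral_le_integral hexp (.of_forall fun ω => by positivity)).trans
          (integral_exp_abs_le hXm hlc hX h2)
    _ = _ := by ring

theorem setIntegral_sq_le_log (hXm : Measurable X) (hlc : IsLogConcaveMeasure (μ.map X))
    (hX : MemLp X 2 μ) (h2 : ∫ ω, X ω ^ 2 ∂μ = 1) {B : Set Ω} (hB : 0 < μ.real B) :
    ∫ ω in B, X ω ^ 2 ∂μ ≤ μ.real B * (256 * Real.log (1 / μ.real B) ^ 2 + 1536) := by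
  have h0 : 0 ≤ Real.log (1 / μ.real B) := by
    refine Real.log_nonneg ?_
    rw [le_div_iff₀ hB, one_mul]
    exact measureReal_le_one
  -- This `T` makes the exponential error equal to the probability of `B`.
  refine (setIntegral_sq_le hXm hlc hX h2 B (16 * Real.log (1 / μ.real B))).trans_eq ?_
  have : Real.exp (-(16 * Real.log (1 / μ.real B)) / 16) = μ.real B := by
    rw [show -(16 * Real.log (1 / μ.real B)) / 16 = Real.log (μ.real B) by simp,
      Real.exp_log hB]
  rw [this]
  ring

/-! ### First absolute moment and small ball probability -/

/-- A universal lower bound for the first absolute moment of a log-concave real random variable of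
unit second moment. -/
noncomputable def absMomentBound : ℝ := 1 / (32 * Real.log 3072)

theorem absMomentBound_pos : 0 < absMomentBound := by
  have := Real.log_pos (show (1 : ℝ) < 3072 by norm_num)
  unfold absMomentBound; positivity

theorem absMomentBound_le_one : absMomentBound ≤ 1 := by
  have h : 1 ≤ Real.log 3072 := by
    rw [Real.le_log_iff_exp_le (by norm_num)]
    exact Real.exp_one_lt_d9.le.trans (by norm_num)
  rw [absMomentBound, div_le_one (by positivity)]
  linarith

theorem absMomentBound_le_integral_abs (hXm : Measurable X)
    (hlc : IsLogConcaveMeasure (μ.map X)) (hX : MemLp X 2 μ) (h2 : ∫ ω, X ω ^ 2 ∂μ = 1) :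
    absMomentBound ≤ ∫ ω, |X ω| ∂μ := by
  have hlog := Real.log_pos (show (1 : ℝ) < 3072 by norm_num)
  -- With this `T` the part `|X| ≥ T` contributes at most 1/2 to the second moment; the rest is at
  -- most `T * |X|`.
  set T := 16 * Real.log 3072 with hT
  have hT0 : 0 < T := by positivity
  have hexp := integrable_exp_abs hXm hlc hX h2
  have hT' : 1536 * Real.exp (-T / 16) = 1 / 2 := by
    rw [hT, show -(16 * Real.log 3072) / 16 = - Real.log 3072 by ring, Real.exp_neg,
      Real.exp_log (by norm_num)]
    norm_num
  have habs : Integrable (fun ω => |X ω|) μ := (hX.integrable one_le_two).abs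
  have h1 : ∫ ω, X ω ^ 2 ∂μ
      ≤ ∫ ω, (T * |X ω| + 512 * Real.exp (-T / 16) * Real.exp (|X ω| / 8)) ∂μ := by
    refine integral_mono hX.integrable_sq ((habs.const_mul _).add (hexp.const_mul _)) fun ω => ?_
    rcases le_total T |X ω| with h | h
    · exact (sq_le_exp_neg_mul_exp_of_le_abs h).trans (by simp; positivity)
    · have : X ω ^ 2 ≤ T * |X ω| := by
        rw [← sq_abs, sq]; gcongr
      exact this.trans (by simp; positivity)
  rw [h2, integral_add (habs.const_mul _) (hexp.const_mul _), integral_const_mul,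
    integral_const_mul] at h1
  have h3 : 512 * Real.exp (-T / 16) * ∫ ω, Real.exp (|X ω| / 8) ∂μ
      ≤ 512 * Real.exp (-T / 16) * 3 := by
    gcongr
    exact integral_exp_abs_le hXm hlc hX h2
  have h4 : absMomentBound = 1 / (2 * T) := by rw [absMomentBound, hT]; ring
  rw [h4, div_le_iff₀ (by positivity)]
  linarith

/-- Mean zero gives `E (|X| + X) = E |X| ≥ κ`, while `|X| + X` vanishes for `X < 0` and AM-GM bounds
it by `κ/2 * X² + 2/κ` elsewhere. -/
theorem sq_div_four_le_measureReal_nonneg (hXm : Measurable X) (hX : MemLp X 2 μ)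
    (h1 : ∫ ω, X ω ∂μ = 0) (h2 : ∫ ω, X ω ^ 2 ∂μ = 1) {κ : ℝ} (hκ : 0 < κ)
    (h : κ ≤ ∫ ω, |X ω| ∂μ) : κ ^ 2 / 4 ≤ μ.real {ω | 0 ≤ X ω} := by
  have hi := hX.integrable one_le_two
  have hS : MeasurableSet {ω | 0 ≤ X ω} := measurableSet_le measurable_const hXm
  have hind : Integrable ({ω | 0 ≤ X ω}.indicator fun _ => (1 : ℝ)) μ :=
    (integrable_const 1).indicator hS
  have h3 : ∫ ω, (|X ω| + X ω) ∂μ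
      ≤ ∫ ω, (κ / 2 * X ω ^ 2 + 2 / κ * {ω | 0 ≤ X ω}.indicator (fun _ => (1 : ℝ)) ω) ∂μ := by
    refine integral_mono (hi.abs.add hi) ((hX.integrable_sq.const_mul _).add (hind.const_mul _))
      fun ω => ?_
    by_cases hω : 0 ≤ X ω
    · have : ω ∈ {ω | 0 ≤ X ω} := hω
      simp only [Set.indicator_of_mem this, abs_of_nonneg hω]
      have e : κ / 2 * X ω ^ 2 + 2 / κ * 1 - (X ω + X ω) = (κ * X ω - 2) ^ 2 / (2 * κ) := by
        field_simp; ring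
      have : 0 ≤ (κ * X ω - 2) ^ 2 / (2 * κ) := by positivity
      linarith
    · have : ω ∉ {ω | 0 ≤ X ω} := hω
      simp only [Set.indicator_of_notMem this, abs_of_neg (not_le.1 hω)]
      have : 0 ≤ κ / 2 * X ω ^ 2 := by positivity
      linarith
  rw [integral_add hi.abs hi, integral_add (hX.integrable_sq.const_mul _) (hind.const_mul _),
    integral_const_mul, integral_const_mul, h1, h2, integral_indicator hS] at h3
  simp only [integral_const, measureReal_restrict_apply_univ, smul_eq_mul, mul_one, add_zero] at h3
  have h4 : κ / 2 ≤ 2 / κ * μ.real {ω | 0 ≤ X ω} := by linarith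
  have h5 : κ * (κ / 2) ≤ κ * (2 / κ * μ.real {ω | 0 ≤ X ω}) := by gcongr
  have h6 : κ * (2 / κ * μ.real {ω | 0 ≤ X ω}) = 2 * μ.real {ω | 0 ≤ X ω} := by field_simp
  linarith

/-- Some interval of radius `s` centred at a nonnegative point carries mass proportional to `s`. -/
theorem exists_nonneg_le_measureReal_abs_sub_le (hXm : Measurable X) (hX : MemLp X 2 μ)
    (h1 : ∫ ω, X ω ∂μ = 0) (h2 : ∫ ω, X ω ^ 2 ∂μ = 1) {κ : ℝ} (hκ : 0 < κ)
    (h : κ ≤ ∫ ω, |X ω| ∂μ) {s : ℝ} (hs0 : 0 < s) (hs1 : s ≤ 1) :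
    ∃ z : ℝ, 0 ≤ z ∧ κ ^ 2 / (8 * (3 / κ + 2)) * s ≤ μ.real {ω | |X ω - z| ≤ s} := by
  -- Chebyshev removes at most `κ² / 9` from `κ² / 4`, leaving more than `κ² / 8` on `[0, M]`.
  -- Pigeonhole over a grid of step `s` then finds the interval.
  set M := 3 / κ with hM
  have hM0 : 0 < M := by positivity
  have hmass : κ ^ 2 / 8 ≤ μ.real {ω | 0 ≤ X ω ∧ X ω ≤ M} := by
    have h3 := sq_div_four_le_measureReal_nonneg hXm hX h1 h2 hκ h
    have h4 := measureReal_lt_abs_le_sq hX hM0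
    have h5 : μ.real {ω | 0 ≤ X ω}
        ≤ μ.real {ω | 0 ≤ X ω ∧ X ω ≤ M} + μ.real {ω | M < |X ω|} := by
      refine (measureReal_mono fun ω hω => ?_).trans (measureReal_union_le _ _)
      rcases le_or_gt (X ω) M with h | h
      · exact Or.inl ⟨hω, h⟩
      · exact Or.inr (h.trans_le (le_abs_self _))
    have h6 : (1 : ℝ) / M ^ 2 = κ ^ 2 / 9 := by rw [hM]; field_simp; norm_num
    rw [h2, h6] at h4
    have : 0 < κ ^ 2 := by positivity
    linarith
  set N := ⌈M / s⌉₊ + 1 with hN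
  have hNs : (N : ℝ) * s ≤ M + 2 := by
    have := (Nat.ceil_lt_add_one (show 0 ≤ M / s by positivity)).le
    calc (N : ℝ) * s ≤ (M / s + 2) * s := by
          gcongr
          rw [hN]; push_cast; linarith
      _ = M + 2 * s := by field_simp
      _ ≤ M + 2 := by linarith
  by_contra! hcon
  have hcover : μ.real {ω | 0 ≤ X ω ∧ X ω ≤ M}
      ≤ ∑ k ∈ Finset.range N, μ.real {ω | |X ω - k * s| ≤ s} := by
    refine (measureReal_mono (fun ω hω => ?_) (measure_ne_top _ _)).trans
      (measureReal_biUnion_finset_le _ _)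
    obtain ⟨ha, hb⟩ : 0 ≤ X ω ∧ X ω ≤ M := hω
    simp only [Set.mem_iUnion, Finset.mem_range]
    refine ⟨⌊X ω / s⌋₊, ?_, ?_⟩
    · have : ⌊X ω / s⌋₊ ≤ ⌈M / s⌉₊ := by
        refine (Nat.floor_le_ceil _).trans (Nat.ceil_mono ?_)
        gcongr
      omega
    · have e1 := Nat.floor_le (show 0 ≤ X ω / s by positivity)
      have e2 := (Nat.lt_floor_add_one (X ω / s)).le
      rw [le_div_iff₀ hs0] at e1
      rw [div_le_iff₀ hs0] at e2
      change |X ω - ⌊X ω / s⌋₊ * s| ≤ s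
      rw [abs_le]
      constructor <;> linarith
  have hN0 : 0 < N := by omega
  have hlt : ∑ k ∈ Finset.range N, μ.real {ω | |X ω - k * s| ≤ s}
      < ∑ _k ∈ Finset.range N, κ ^ 2 / (8 * (M + 2)) * s :=
    Finset.sum_lt_sum_of_nonempty (by simp) fun k _ => hcon _ (by positivity)
  rw [Finset.sum_const, Finset.card_range, nsmul_eq_mul] at hlt
  have : (N : ℝ) * (κ ^ 2 / (8 * (M + 2)) * s) ≤ κ ^ 2 / 8 := by
    calc (N : ℝ) * (κ ^ 2 / (8 * (M + 2)) * s) = κ ^ 2 / (8 * (M + 2)) * (N * s) := by ring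
      _ ≤ κ ^ 2 / (8 * (M + 2)) * (M + 2) := by gcongr
      _ = κ ^ 2 / 8 := by field_simp
  linarith

/-- A universal constant in the small ball estimate for isotropic log-concave real variables. -/
noncomputable def smallBallConst : ℝ := absMomentBound ^ 2 / (8 * (3 / absMomentBound + 2))

theorem smallBallConst_pos : 0 < smallBallConst := by
  have := absMomentBound_pos
  unfold smallBallConst; positivity

theorem smallBallConst_le_one : smallBallConst ≤ 1 := by
  have h0 := absMomentBound_pos
  have h1 := pow_le_one₀ (n := 2) h0.le absMomentBound_le_one
  have h2 : 0 < 3 / absMomentBound := by positivity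
  rw [smallBallConst, div_le_one (by positivity)]
  linarith

/-- Applied to `X` and `-X`, the pigeonhole bound gives heavy intervals centred on either side of 0.
The convex combination moving their centres to 0 keeps the radius, and log-concavity keeps the mass.
-/
theorem smallBallConst_mul_le_measureReal (hXm : Measurable X)
    (hlc : IsLogConcaveMeasure (μ.map X)) (hX : MemLp X 2 μ) (h1 : ∫ ω, X ω ∂μ = 0)
    (h2 : ∫ ω, X ω ^ 2 ∂μ = 1) {s : ℝ} (hs0 : 0 < s) (hs1 : s ≤ 1) :
    smallBallConst * s ≤ μ.real {ω | |X ω| ≤ s} := by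
  have : IsProbabilityMeasure (μ.map X) := Measure.isProbabilityMeasure_map hXm.aemeasurable
  have hκ := absMomentBound_le_integral_abs hXm hlc hX h2
  obtain ⟨z, hz0, hz⟩ := exists_nonneg_le_measureReal_abs_sub_le hXm hX h1 h2
    absMomentBound_pos hκ hs0 hs1
  obtain ⟨w, hw0, hw⟩ := exists_nonneg_le_measureReal_abs_sub_le (X := fun ω => - X ω) hXm.neg
    hX.neg (by rw [integral_neg, h1, neg_zero]) (by simpa using h2) absMomentBound_pos
    (by simpa using hκ) hs0 hs1
  rw [← smallBallConst] at hz hw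
  have hw' : {ω | |-X ω - w| ≤ s} = {ω | |X ω - -w| ≤ s} := by
    ext ω
    change |-X ω - w| ≤ s ↔ |X ω - -w| ≤ s
    rw [← abs_neg]; ring_nf
  rw [hw'] at hw
  have mI : ∀ z : ℝ, MeasurableSet {x : ℝ | |x - z| ≤ s} := fun z =>
    measurableSet_le (measurable_id.sub_const z).abs measurable_const
  have hreal : ∀ z, μ.real {ω | |X ω - z| ≤ s} = (μ.map X).real {x : ℝ | |x - z| ≤ s} := fun z => by
    rw [map_measureReal_apply hXm (mI z)]; rfl
  rcases eq_or_lt_of_le hz0 with rfl | hz0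
  · simpa using hz
  rcases eq_or_lt_of_le hw0 with rfl | hw0
  · simpa using hw
  have hl0 : 0 < w / (z + w) := by positivity
  have hl1 : w / (z + w) < 1 := by rw [div_lt_one (by positivity)]; linarith
  have hzw : (1 - w / (z + w)) * -w + w / (z + w) * z = 0 := by field_simp; ring
  have key := hlc.real_le hl0 hl1 (mI (-w)) (mI z) (mI 0) (by
    set l := w / (z + w)
    intro x hx y hy
    have hx : |x - -w| ≤ s := hx
    have hy : |y - z| ≤ s := hy
    change |(1 - l) • x + l • y - 0| ≤ s
    have e : (1 - l) • x + l • y - 0 = (1 - l) * (x - -w) + l * (y - z) := by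
      simp only [smul_eq_mul]; linear_combination hzw
    rw [e]
    refine (abs_add_le _ _).trans ?_
    rw [abs_mul, abs_mul, abs_of_pos hl0, abs_of_pos (sub_pos.2 hl1)]
    have e1 : (1 - l) * |x - -w| ≤ (1 - l) * s := by
      gcongr
    have e2 : l * |y - z| ≤ l * s := by gcongr
    linarith)
  rw [← hreal, ← hreal, ← hreal] at key
  simp only [sub_zero] at key
  refine le_trans ?_ key
  have hc : 0 < smallBallConst * s := mul_pos smallBallConst_pos hs0
  set l := w / (z + w)
  calc smallBallConst * s = (smallBallConst * s) ^ (1 - l) * (smallBallConst * s) ^ l := by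
        rw [← Real.rpow_add hc]; simp
    _ ≤ _ := by
        gcongr

end LogConcaveVariable

/-! ### Probability and conditional moments of the band -/

theorem Real.log_one_add_mul_le {w t : ℝ} (hw : 1 ≤ w) (ht : 0 ≤ t) :
    Real.log (1 + w * t) ≤ w * Real.log (1 + t) := by
  rw [← Real.log_rpow (by linarith)]
  exact Real.log_le_log (by positivity) (one_add_mul_self_le_rpow_one_add (by linarith) hw)

namespace IsIsotropicLogConcave

variable {d : ℕ} {D : Measure (EuclideanSpace ℝ (Fin d))}

theorem smallBallConst_mul_le_measureReal_band (hD : IsIsotropicLogConcave D)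
    {u : EuclideanSpace ℝ (Fin d)} {γ s : ℝ} (hs0 : 0 < s) (hs1 : s ≤ 1) (h : s * ‖u‖ ≤ γ) :
    smallBallConst * s ≤ D.real (band u γ) := by
  have := hD.isProbabilityMeasure
  rcases eq_or_ne u 0 with rfl | hu
  · have hband : band (0 : EuclideanSpace ℝ (Fin d)) γ = Set.univ := by
      ext x
      simpa [band] using h
    rw [hband, probReal_univ]
    exact mul_le_one₀ smallBallConst_le_one hs0.le hs1
  · have hu0 : 0 < ‖u‖ := norm_pos_iff.2 hu
    have hb : ‖‖u‖⁻¹ • u‖ = 1 := by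
      rw [norm_smul, norm_inv, norm_norm, inv_mul_cancel₀ hu0.ne']
    refine (smallBallConst_mul_le_measureReal (by fun_prop)
      (hD.isLogConcaveMeasure_map_inner (‖u‖⁻¹ • u)) (hD.memLp_inner _)
      (hD.integral_inner_eq_zero _) (by rw [hD.integral_inner_sq, hb, one_pow]) hs0 hs1).trans
      (measureReal_mono fun x hx => ?_)
    have hx : |inner ℝ (‖u‖⁻¹ • u) x| ≤ s := hx
    change |inner ℝ u x| ≤ γ
    rw [real_inner_smul_left, abs_mul, abs_inv, abs_norm, inv_mul_le_iff₀ hu0] at hx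
    linarith

theorem setIntegral_inner_sq_le (hD : IsIsotropicLogConcave D) (b : EuclideanSpace ℝ (Fin d))
    {B : Set (EuclideanSpace ℝ (Fin d))} (hB : 0 < D.real B) :
    ∫ x in B, (inner ℝ b x : ℝ) ^ 2 ∂D
      ≤ ‖b‖ ^ 2 * (D.real B * (256 * Real.log (1 / D.real B) ^ 2 + 1536)) := by
  have := hD.isProbabilityMeasure
  rcases eq_or_ne b 0 with rfl | hb
  · simp
  have hb0 : 0 < ‖b‖ := norm_pos_iff.2 hb
  have hn : ‖‖b‖⁻¹ • b‖ = 1 := by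
    rw [norm_smul, norm_inv, norm_norm, inv_mul_cancel₀ hb0.ne']
  have h := setIntegral_sq_le_log (by fun_prop)
    (hD.isLogConcaveMeasure_map_inner (‖b‖⁻¹ • b)) (hD.memLp_inner _)
    (by rw [hD.integral_inner_sq, hn, one_pow]) hB
  have e : ∀ x, (inner ℝ b x : ℝ) ^ 2 = ‖b‖ ^ 2 * (inner ℝ (‖b‖⁻¹ • b) x : ℝ) ^ 2 := fun x => by
    rw [real_inner_smul_left]; field_simp
  simp only [e, integral_const_mul]
  gcongr

theorem integrable_bandCond (hD : IsIsotropicLogConcave D) {u : EuclideanSpace ℝ (Fin d)} {γ : ℝ}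
    (h : 0 < D (band u γ)) (b : EuclideanSpace ℝ (Fin d)) :
    Integrable (fun x => (inner ℝ b x : ℝ) ^ 2) (bandCond D u γ) :=
  (hD.memLp_inner b).integrable_sq.integrableOn.integrable.smul_measure
    (ENNReal.inv_ne_top.2 h.ne')

theorem integral_bandCond_inner_sq_le (hD : IsIsotropicLogConcave D)
    {u : EuclideanSpace ℝ (Fin d)} {γ : ℝ} (h : 0 < D (band u γ))
    (b : EuclideanSpace ℝ (Fin d)) :
    ∫ x, (inner ℝ b x : ℝ) ^ 2 ∂(bandCond D u γ)
      ≤ ‖b‖ ^ 2 * (256 * Real.log (1 / D.real (band u γ)) ^ 2 + 1536) := by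
  have := hD.isProbabilityMeasure
  have hp : 0 < D.real (band u γ) := ENNReal.toReal_pos h.ne' (measure_ne_top _ _)
  rw [bandCond, ProbabilityTheory.cond, integral_smul_measure, ENNReal.toReal_inv, smul_eq_mul,
    ← measureReal_def, inv_mul_le_iff₀ hp]
  refine (hD.setIntegral_inner_sq_le b hp).trans_eq ?_
  ring

theorem log_one_div_measureReal_band_le (hD : IsIsotropicLogConcave D)
    {u : EuclideanSpace ℝ (Fin d)} {γ w : ℝ} (hγ : 0 < γ) (hw : 1 ≤ w) (hu : ‖u‖ ≤ w) :
    0 < D.real (band u γ) ∧ 0 ≤ Real.log (1 / D.real (band u γ)) ∧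
      Real.log (1 / D.real (band u γ))
        ≤ Real.log (1 / smallBallConst) + w * Real.log (1 + 1 / γ) := by
  have := hD.isProbabilityMeasure
  have hc := smallBallConst_pos
  have hw0 : 0 < w := by linarith
  -- A smooth substitute for `min 1 (γ / w)`: it satisfies `s ≤ 1` and `s * w ≤ γ`, and its
  -- logarithm has the form required by Bernoulli's inequality.
  set s := 1 / (1 + w * (1 / γ)) with hs
  have hs0 : 0 < s := by positivity
  have hs1 : s ≤ 1 := by
    rw [hs, div_le_one (by positivity)]
    have : 0 < w * (1 / γ) := by positivity
    linarith
  have hsu : s * ‖u‖ ≤ γ := by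
    calc s * ‖u‖ ≤ s * w := by gcongr
      _ ≤ γ := by
        rw [hs, div_mul_eq_mul_div, div_le_iff₀ (by positivity)]
        have : γ * (1 + w * (1 / γ)) = γ + w := by field_simp
        linarith
  have hp := hD.smallBallConst_mul_le_measureReal_band hs0 hs1 hsu
  have hp0 : 0 < D.real (band u γ) := lt_of_lt_of_le (by positivity) hp
  refine ⟨hp0, Real.log_nonneg ?_, ?_⟩
  · rw [le_div_iff₀ hp0, one_mul]
    exact measureReal_le_one
  · calc Real.log (1 / D.real (band u γ)) ≤ Real.log (1 / (smallBallConst * s)) := by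
          gcongr
      _ = Real.log (1 / smallBallConst) + Real.log (1 + w * (1 / γ)) := by
          rw [← Real.log_mul (by positivity) (by positivity), hs]
          congr 1
          field_simp
      _ ≤ _ := by
          gcongr
          exact Real.log_one_add_mul_le hw (by positivity)

end IsIsotropicLogConcave

theorem measurableSet_band {d : ℕ} (u : EuclideanSpace ℝ (Fin d)) (γ : ℝ) :
    MeasurableSet (band u γ) :=
  measurableSet_le (by fun_prop) measurable_const

theorem IsIsotropicLogConcave.integral_bandCond_inner_sq_le_add {d : ℕ}
    {D : Measure (EuclideanSpace ℝ (Fin d))} (hD : IsIsotropicLogConcave D)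
    {u : EuclideanSpace ℝ (Fin d)} {γ : ℝ} (h : 0 < D (band u γ))
    (a : EuclideanSpace ℝ (Fin d)) :
    ∫ x, (inner ℝ a x : ℝ) ^ 2 ∂(bandCond D u γ)
      ≤ 2 * γ ^ 2 + 2 * ∫ x, (inner ℝ (u - a) x : ℝ) ^ 2 ∂(bandCond D u γ) := by
  have := hD.isProbabilityMeasure
  have : IsProbabilityMeasure (bandCond D u γ) := cond_isProbabilityMeasure h.ne'
  have hi := (hD.integrable_bandCond h (u - a)).const_mul 2
  have hle : ∫ x, (inner ℝ a x : ℝ) ^ 2 ∂(bandCond D u γ)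
      ≤ ∫ x, (2 * γ ^ 2 + 2 * (inner ℝ (u - a) x : ℝ) ^ 2) ∂(bandCond D u γ) := by
    refine integral_mono_ae (hD.integrable_bandCond h a) ((integrable_const _).add hi) ?_
    filter_upwards [ae_cond_mem (measurableSet_band u γ)] with x hx
    have hx : |inner ℝ u x| ≤ γ := hx
    have h1 : (inner ℝ u x : ℝ) ^ 2 ≤ γ ^ 2 := by rw [← sq_abs]; gcongr
    rw [inner_sub_left]
    -- With `p = u · x` and `q = a · x`, `2 p² + 2 (p - q)² - q² = (2 p - q)²`.
    nlinarith [sq_nonneg (2 * inner ℝ u x - inner ℝ a x : ℝ)]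
  rwa [integral_add (integrable_const _) hi, integral_const, probReal_univ, one_smul,
    integral_const_mul] at hle

/-! ### Assembling the bound -/

theorem mainTheorem9 :
    ∀ C : ℝ, ∃ c : ℝ, 0 < c ∧
      ∀ (d : ℕ) (D : Measure (EuclideanSpace ℝ (Fin d))), IsIsotropicLogConcave D →
      ∀ (u a : EuclideanSpace ℝ (Fin d)) (r γ : ℝ),
        0 < γ → γ ≤ C → ‖a‖ ≤ 1 → ‖u - a‖ ≤ r →
          0 < D (band u γ) ∧
          Integrable (fun x => (inner ℝ a x) ^ 2) (bandCond D u γ) ∧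
          ∫ x, (inner ℝ a x) ^ 2 ∂(bandCond D u γ)
            ≤ c * (r ^ 2 + γ ^ 2) * (Real.log (1 + 1 / γ)) ^ 2 := by
  intro C
  -- A positive lower bound for `ln (1 + 1/γ)`; the maximum keeps it meaningful when `C ≤ 0`.
  set L₀ := Real.log (1 + 1 / max C 1) with hL₀
  have hC0 : 0 < max C 1 := by positivity
  have hL0 : 0 < L₀ := Real.log_pos (by simp)
  set K := Real.log (1 / smallBallConst) with hK
  have hK0 : 0 ≤ K := Real.log_nonneg (by
    rw [le_div_iff₀ smallBallConst_pos, one_mul]; exact smallBallConst_le_one)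
  set Q := 256 * (K / L₀ + 1) ^ 2 + 1536 / L₀ ^ 2 with hQ
  have hQ0 : 0 < Q := by positivity
  -- `2 / L₀ ^ 2` pays for the term `2 γ²`, and `8 = 2 * 2²` comes from the splitting with `w = 2`.
  -- The case `‖u‖ > 2` needs only `4 * Q`.
  refine ⟨2 / L₀ ^ 2 + 8 * Q, by positivity, ?_⟩
  intro d D hD u a r γ hγ hγC ha hua
  have := hD.isProbabilityMeasure
  set L := Real.log (1 + 1 / γ) with hL
  have hLL : L₀ ≤ L := by
    rw [hL, hL₀]
    gcongr
    exact hγC.trans (le_max_left _ _)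
  have hLpos : 0 < L := hL0.trans_le hLL
  have hr : 0 ≤ r := (norm_nonneg _).trans hua
  have hpos : 0 < D (band u γ) := by
    have := (hD.log_one_div_measureReal_band_le hγ (le_max_right ‖u‖ 1) (le_max_left _ _)).1
    exact (ENNReal.toReal_pos_iff.1 this).1
  have hratio : 1 ≤ L / L₀ := (one_le_div hL0).2 hLL
  have hbound : ∀ w, 1 ≤ w → ‖u‖ ≤ w →
      256 * Real.log (1 / D.real (band u γ)) ^ 2 + 1536 ≤ Q * (w ^ 2 * L ^ 2) := by
    intro w hw huw
    obtain ⟨-, h0, h1⟩ := hD.log_one_div_measureReal_band_le hγ hw huw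
    have hwr : 1 ≤ w * (L / L₀) := one_le_mul_of_one_le_of_one_le hw hratio
    have h2 : Real.log (1 / D.real (band u γ)) ≤ (K / L₀ + 1) * (w * L) := by
      calc _ ≤ K + w * L := h1
        _ ≤ K * (w * (L / L₀)) + w * L := by gcongr; exact le_mul_of_one_le_right hK0 hwr
        _ = _ := by ring
    have h3 : (1536 : ℝ) ≤ 1536 * (w * (L / L₀)) ^ 2 :=
      le_mul_of_one_le_right (by norm_num) (one_le_pow₀ hwr)
    calc _ ≤ 256 * ((K / L₀ + 1) * (w * L)) ^ 2 + 1536 * (w * (L / L₀)) ^ 2 := by gcongr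
      _ = _ := by rw [hQ]; ring
  refine ⟨hpos, hD.integrable_bandCond hpos a, ?_⟩
  rcases le_or_gt ‖u‖ 2 with hu | hu
  · have h1 := hD.integral_bandCond_inner_sq_le hpos (u - a)
    have h2 : ∫ x, (inner ℝ (u - a) x : ℝ) ^ 2 ∂(bandCond D u γ) ≤ r ^ 2 * (Q * (2 ^ 2 * L ^ 2)) := by
      refine h1.trans ?_
      gcongr
      exact hbound 2 one_le_two hu
    have h3 : 2 * γ ^ 2 ≤ 2 * γ ^ 2 * (L / L₀) ^ 2 :=
      le_mul_of_one_le_right (by positivity) (one_le_pow₀ hratio)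
    calc _ ≤ 2 * γ ^ 2 + 2 * ∫ x, (inner ℝ (u - a) x : ℝ) ^ 2 ∂(bandCond D u γ) :=
          hD.integral_bandCond_inner_sq_le_add hpos a
      _ ≤ 2 * γ ^ 2 * (L / L₀) ^ 2 + 2 * (r ^ 2 * (Q * (2 ^ 2 * L ^ 2))) := by gcongr
      _ = 2 / L₀ ^ 2 * γ ^ 2 * L ^ 2 + 8 * Q * r ^ 2 * L ^ 2 := by ring
      _ ≤ 2 / L₀ ^ 2 * (r ^ 2 + γ ^ 2) * L ^ 2 + 8 * Q * (r ^ 2 + γ ^ 2) * L ^ 2 := by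
          gcongr <;> linarith [sq_nonneg r, sq_nonneg γ]
      _ = _ := by ring
  -- Here `r ≥ ‖u‖ - 1 ≥ ‖u‖ / 2`, so `a` is estimated directly, with `w = ‖u‖`.
  · have hur : ‖u‖ ≤ 2 * r := by
      have := norm_sub_norm_le u a
      linarith
    calc _ ≤ ‖a‖ ^ 2 * (256 * Real.log (1 / D.real (band u γ)) ^ 2 + 1536) :=
          hD.integral_bandCond_inner_sq_le hpos a
      _ ≤ 1 ^ 2 * (Q * (‖u‖ ^ 2 * L ^ 2)) := by
          gcongr
          exact hbound _ (by linarith) le_rfl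
      _ ≤ 1 ^ 2 * (Q * ((2 * r) ^ 2 * L ^ 2)) := by gcongr
      _ = 4 * Q * r ^ 2 * L ^ 2 := by ring
      _ ≤ (2 / L₀ ^ 2 + 8 * Q) * (r ^ 2 + γ ^ 2) * L ^ 2 := by
          gcongr
          · have : 0 < 2 / L₀ ^ 2 := by positivity
            linarith
          · linarith [sq_nonneg γ]
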